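/- For $\pi=[\pi_1,\dots,\pi_n]\in S_n$, a digit $\pi_i$ with $1<i<n$ is a *vertical separator* of $\pi$ if $|\pi_{i-1}-\pi_{i+1}|=1$. A digit $a$ with $1<a<n$ is a *horizontal separator* of $\pi$ if $a-1$ and $a+1$ stand in adjacent positions of $\pi$ (in either order). Let $s_{n,m}$ be the number of $\pi\in S_n$ with exactly $m$ vertical separators and let $$h(z,u)=\sum_{n\ge 0}\sum_{m=0}^{n}s_{n,m}\,z^nu^m\in\mathbb{Q}[[u]][[z]].$$ For Laurent series in $z$ over $\mathbb{Q}[[u]]$, let $*$ denote the Hadamard product with respect to $z$: $\bigl(\sum_k a_kz^k\bigr)*\bigl(\sum_k b_kz^k\bigr)=\sum_k a_kb_kz^k$, where $a_k,b_k\in\mathbb{Q}[[u]]$. Put $$w=z^2+\frac{2z^4(u-1)}{1-z^2(u-1)}\in\mathbb{Q}[[u]][[z]].$$ **Theorem.** The two families below, indexed by $(m_o,m_e)$, are summable as formal Laurent series in $z$ over $\mathbb{Q}[[u]]$ (in particular each power of $z$ has a nonzero coefficient in only finitely many terms), and $$h(z,u)=\sum_{m_o,m_e\ge 0}(m_o+m_e)!\,\bigl[w^{m_o}\bigr]*\bigl[w^{m_e}\bigr]+\sum_{m_o,m_e\ge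 0}(m_o+m_e)!\,\Bigl[w^{m_o}\,\frac1z\Bigr]*\bigl[w^{m_e}\,z\bigr].$$ The generating function obtained by counting horizontal instead of vertical separators is equal to the same expression. -/

import Mathlib

open scoped Nat

namespace PermSep

/-- The set of vertical separators of `π`: the digits `b` whose two neighbours in the one-line
notation of `π` exist and differ by exactly one. (Positions and digits are numbered
`0, …, n - 1` instead of `1, …, n`; this shift affects neither adjacency nor counting.) -/
def verticalSeparators {n : ℕ} (π : Equiv.Perm (Fin n)) : Finset (Fin n) :=
  Finset.univ.filter fun b => ∃ j₁ i j₂ : Fin n, π i = b ∧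
    (j₁ : ℕ) + 1 = i ∧ (i : ℕ) + 1 = j₂ ∧
    ((π j₁ : ℕ) + 1 = π j₂ ∨ (π j₂ : ℕ) + 1 = π j₁)

/-- The set of horizontal separators of `π`: the digits `a` such that both `a - 1` and `a + 1`
are digits and they stand next to each other (in either order) in the one-line notation. -/
def horizontalSeparators {n : ℕ} (π : Equiv.Perm (Fin n)) : Finset (Fin n) :=
  Finset.univ.filter fun a => ∃ j₁ j₂ : Fin n,
    (π j₁ : ℕ) + 1 = a ∧ (a : ℕ) + 1 = π j₂ ∧
    ((j₁ : ℕ) + 1 = j₂ ∨ (j₂ : ℕ) + 1 = j₁)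

/-- The number of permutations of size `n` with exactly `m` vertical separators. -/
def numVertical (n m : ℕ) : ℕ :=
  (Finset.univ.filter fun π : Equiv.Perm (Fin n) => (verticalSeparators π).card = m).card

/-- The number of permutations of size `n` with exactly `m` horizontal separators. -/
def numHorizontal (n m : ℕ) : ℕ :=
  (Finset.univ.filter fun π : Equiv.Perm (Fin n) => (horizontalSeparators π).card = m).card

noncomputable section

/-- The ring `ℚ[[u]]`. -/
abbrev QU : Type := PowerSeries ℚ

/-- The ring `ℚ[[u]][[z]]`. -/
abbrev QUZ : Type := PowerSeries QU

/-- The variable `u` as an element of `ℚ[[u]][[z]]`. -/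
def u : QUZ := PowerSeries.C (PowerSeries.X : QU)

/-- The variable `z` of `ℚ[[u]][[z]]`. -/
def z : QUZ := PowerSeries.X

/-- `∑_{n ≥ 0} ∑_{m = 0}^{n} s n m z ^ n u ^ m` as an element of `ℚ[[u]][[z]]`. -/
def bivariateGF (s : ℕ → ℕ → ℕ) : QUZ :=
  PowerSeries.mk fun n =>
    ∑ m ∈ Finset.range (n + 1), PowerSeries.C (s n m : ℚ) * (PowerSeries.X : QU) ^ m

/-- The generating function `h(z,u)` of permutations by size and number of vertical separators. -/
def verticalGF : QUZ := bivariateGF numVertical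

/-- The generating function of permutations by size and number of horizontal separators. -/
def horizontalGF : QUZ := bivariateGF numHorizontal

/-- `z² + 2 z⁴ (u - 1) / (1 - z² (u - 1))` in `ℚ[[u]][[z]]`. The denominator has constant
coefficient `1` in `z`, and `invOfUnit _ 1` is its inverse, see `denominator_mul_inv`. -/
def w : QUZ :=
  z ^ 2 + 2 * z ^ 4 * (u - 1) * PowerSeries.invOfUnit (1 - z ^ 2 * (u - 1)) 1

theorem denominator_mul_inv :
    (1 - z ^ 2 * (u - 1)) * PowerSeries.invOfUnit (1 - z ^ 2 * (u - 1)) 1 = 1 := by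
  apply PowerSeries.mul_invOfUnit
  simp [z]

/-- The Hadamard (coefficientwise) product of Laurent series; on power series it is the usual
Hadamard product, see `hadamard_coe`. -/
def hadamard {R : Type*} [Semiring R] (f g : LaurentSeries R) : LaurentSeries R where
  coeff k := f.coeff k * g.coeff k
  isPWO_support' := f.isPWO_support.mono fun k hk h => hk (by simp [h])

theorem hadamard_coe {R : Type*} [Semiring R] (f g : PowerSeries R) :
    hadamard (f : LaurentSeries R) (g : LaurentSeries R) =
      ((PowerSeries.mk fun n => PowerSeries.coeff n f * PowerSeries.coeff n g : PowerSeries R) :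
        LaurentSeries R) := by
  ext k
  simp only [hadamard, PowerSeries.coeff_coe, PowerSeries.coeff_mk]
  split_ifs <;> simp

/-- The Laurent monomial `1 / z` over `ℚ[[u]]`. -/
def zInv : LaurentSeries QU := HahnSeries.single (-1) 1

theorem z_mul_zInv : (z : LaurentSeries QU) * zInv = 1 := by
  simp [z, zInv]

end

end PermSep

/-! A vertical separator compares the values at two positions that are two apart. Listing the
positions of one parity before those of the other turns vertical separators into consecutive entries
of a word with values differing by one, except that the gap between the two halves does not count.
Expanding `u = 1 + (u - 1)` at each gap gives a sum over sets of marked gaps, each forced to join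
adjacent values. A marking with `m` blocks is satisfied by `m!` permutations times 2 for each block
of length at least 2, its orientation (`numCompat_succ`, `numCompat_succ_insert`). So the count is
the functional `X ^ m ↦ m!` applied to a polynomial recording blocks, which factors at the middle
gap (`blockPoly_mul_blockPoly`).

A block of length `j` weighs `1` if `j = 1` and `2 (u - 1) ^ (j - 1)` otherwise, so `w` is the
generating series of one block with `z ^ 2` per position, and `coeff_w_pow` identifies the factors
with coefficients of `w ^ m`. As `w` is even in `z`, the first family yields even sizes; the shifts
by `1 / z` and `z` in the second give the unequal halves of odd sizes. Inversion exchanges vertical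
and horizontal separators. -/

namespace PermSep

/-! ### Counting permutations compatible with a set of marked gaps -/

/-- Two natural numbers differ by exactly one. -/
def Adj (x y : ℕ) : Prop := x + 1 = y ∨ y + 1 = x

instance (x y : ℕ) : Decidable (Adj x y) := inferInstanceAs (Decidable (_ ∨ _))

/-- The one-line notation of a permutation as a function on `ℕ`, zero outside the range. -/
def word {n : ℕ} (σ : Equiv.Perm (Fin n)) (j : ℕ) : ℕ := if h : j < n then σ ⟨j, h⟩ else 0

theorem word_of_lt {n : ℕ} (σ : Equiv.Perm (Fin n)) {j : ℕ} (h : j < n) :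
    word σ j = σ ⟨j, h⟩ := dif_pos h

theorem word_lt {n : ℕ} (σ : Equiv.Perm (Fin n)) {j : ℕ} (h : j < n) : word σ j < n := by
  rw [word_of_lt σ h]; exact (σ _).2

theorem word_injOn {n : ℕ} (σ : Equiv.Perm (Fin n)) {i j : ℕ} (hi : i < n) (hj : j < n)
    (h : word σ i = word σ j) : i = j := by
  rw [word_of_lt σ hi, word_of_lt σ hj] at h
  simpa using σ.injective (Fin.ext h)

/-- All gaps in `s` separate values of `σ` that differ by one. -/
def Compat {n : ℕ} (σ : Equiv.Perm (Fin n)) (s : Finset ℕ) : Prop :=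
  ∀ j ∈ s, Adj (word σ j) (word σ (j + 1))

instance {n : ℕ} (σ : Equiv.Perm (Fin n)) (s : Finset ℕ) : Decidable (Compat σ s) :=
  inferInstanceAs (Decidable (∀ j ∈ s, _))

/-- Append the value `v` to the one-line notation of `σ`, raising the values `≥ v`. -/
noncomputable def appendValue {n : ℕ} (v : Fin (n + 1)) (σ : Equiv.Perm (Fin n)) :
    Equiv.Perm (Fin (n + 1)) :=
  Equiv.ofBijective (Fin.snoc (α := fun _ => Fin (n + 1)) (fun i => v.succAbove (σ i)) v) <| by
    rw [← Finite.injective_iff_bijective, Fin.snoc_injective_iff]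
    refine ⟨fun i j h => σ.injective (Fin.succAbove_right_injective h), ?_⟩
    rintro ⟨i, hi⟩
    exact Fin.succAbove_ne _ _ hi

theorem word_appendValue_last {n : ℕ} (v : Fin (n + 1)) (σ : Equiv.Perm (Fin n)) :
    word (appendValue v σ) n = v := by
  rw [word_of_lt _ n.lt_succ_self]
  have : (⟨n, n.lt_succ_self⟩ : Fin (n + 1)) = Fin.last n := rfl
  simp [this, appendValue]

theorem word_appendValue {n : ℕ} (v : Fin (n + 1)) (σ : Equiv.Perm (Fin n)) {j : ℕ} (hj : j < n) :
    word (appendValue v σ) j = if word σ j < v then word σ j else word σ j + 1 := by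
  rw [word_of_lt _ (hj.trans n.lt_succ_self), word_of_lt _ hj]
  have : (⟨j, hj.trans n.lt_succ_self⟩ : Fin (n + 1)) = Fin.castSucc ⟨j, hj⟩ := rfl
  simp only [this, appendValue, Equiv.ofBijective_apply, Fin.snoc_castSucc, Fin.succAbove,
    Fin.lt_def, Fin.val_castSucc]
  split_ifs <;> simp

theorem appendValue_bijective (n : ℕ) :
    Function.Bijective fun p : Fin (n + 1) × Equiv.Perm (Fin n) => appendValue p.1 p.2 := by
  rw [Fintype.bijective_iff_injective_and_card]
  constructor
  · rintro ⟨v, σ⟩ ⟨v', σ'⟩ h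
    have hv : v = v' := by
      have := congrArg (fun ρ => word ρ n) h
      simp only [word_appendValue_last] at this
      exact Fin.ext this
    subst hv
    have hσ : σ = σ' := by
      ext i
      have := congrArg (fun ρ : Equiv.Perm (Fin (n + 1)) => ρ i.castSucc) h
      simp only [appendValue, Equiv.ofBijective_apply, Fin.snoc_castSucc] at this
      exact congrArg Fin.val (Fin.succAbove_right_injective this)
    rw [hσ]
  · simp [Fintype.card_perm, Nat.factorial_succ]

/-- The values whose appending would separate a pair of adjacent values at a gap in `s`. -/
def slots {n : ℕ} (σ : Equiv.Perm (Fin n)) (s : Finset ℕ) : Finset ℕ :=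
  s.image fun j => max (word σ j) (word σ (j + 1))

/-- Raising the values `≥ v` never makes two values adjacent, and it separates an adjacent pair
exactly when `v` is the larger of the two. -/
theorem compat_appendValue {n : ℕ} (v : Fin (n + 1)) (σ : Equiv.Perm (Fin n)) {s : Finset ℕ}
    (hs : ∀ j ∈ s, j + 1 < n) :
    Compat (appendValue v σ) s ↔ Compat σ s ∧ (v : ℕ) ∉ slots σ s := by
  simp only [Compat, slots, Finset.mem_image, not_exists, not_and, ← forall₂_and]
  refine forall₂_congr fun j hj => ?_
  rw [word_appendValue v σ (hs j hj), word_appendValue v σ (j.lt_succ_self.trans (hs j hj))]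
  have hne : word σ j ≠ word σ (j + 1) := fun h => by
    have := word_injOn σ (j.lt_succ_self.trans (hs j hj)) (hs j hj) h
    omega
  unfold Adj
  split_ifs <;> omega

/-- An adjacent pair of values is determined by its maximum, and the pair of values determines the
gap. -/
theorem slots_injOn {n : ℕ} {σ : Equiv.Perm (Fin n)} {s : Finset ℕ}
    (hs : ∀ j ∈ s, j + 1 < n) (h : Compat σ s) :
    Set.InjOn (fun j => max (word σ j) (word σ (j + 1))) s := by
  intro i hi j hj hij
  have hi' := h i hi
  have hj' := h j hj
  have h1 := hs i hi
  have h2 := hs j hj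
  have e1 := word_injOn σ (i := i) (j := j) (by omega) (by omega)
  have e2 := word_injOn σ (i := i) (j := j + 1) (by omega) (by omega)
  have e3 := word_injOn σ (i := i + 1) (j := j) (by omega) (by omega)
  have e4 := word_injOn σ (i := i + 1) (j := j + 1) (by omega) (by omega)
  unfold Adj at hi' hj'
  simp only at hij
  omega

/-- The number of permutations of `Fin (n + 1)` compatible with `s`. -/
def numCompat (n : ℕ) (s : Finset ℕ) : ℕ :=
  (Finset.univ.filter fun σ : Equiv.Perm (Fin (n + 1)) => Compat σ s).card

theorem numCompat_zero : numCompat 0 ∅ = 1 := by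
  simp [numCompat, Compat]

theorem card_filter_appendValue (n : ℕ) (p : ℕ → Equiv.Perm (Fin n) → Prop)
    [∀ v, DecidablePred (p v)] (q : Equiv.Perm (Fin (n + 1)) → Prop) [DecidablePred q]
    (r : Equiv.Perm (Fin n) → Prop) [DecidablePred r] (c : ℕ)
    (hq : ∀ v σ, q (appendValue v σ) ↔ r σ ∧ p v σ)
    (hc : ∀ σ, r σ → ((Finset.range (n + 1)).filter fun v => p v σ).card = c) :
    (Finset.univ.filter q).card = c * (Finset.univ.filter r).card := by
  simp only [Finset.card_filter]
  rw [← (appendValue_bijective n).sum_comp, Fintype.sum_prod_type_right, Finset.mul_sum]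
  refine Finset.sum_congr rfl fun σ _ => ?_
  simp only [hq]
  by_cases hr : r σ
  · simp only [hr, true_and, if_true, mul_one]
    rw [← hc σ hr, Finset.card_filter, Finset.sum_range]
  · simp [hr]

theorem numCompat_succ {n : ℕ} {s : Finset ℕ} (hs : s ⊆ Finset.range n) :
    numCompat (n + 1) s = (n + 2 - s.card) * numCompat n s := by
  have hs' : ∀ j ∈ s, j + 1 < n + 1 := fun j hj => by simpa using hs hj
  refine card_filter_appendValue (n + 1) (fun v σ => v ∉ slots σ s) _ _ _
    (fun v σ => compat_appendValue v σ hs') fun σ hσ => ?_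
  rw [Finset.filter_notMem_eq_sdiff, Finset.card_sdiff_of_subset, Finset.card_range, slots,
    Finset.card_image_of_injOn (slots_injOn hs' hσ)]
  intro v hv
  obtain ⟨j, hj, rfl⟩ := Finset.mem_image.1 hv
  have := word_lt σ (hs' j hj)
  have := word_lt σ (j.lt_succ_self.trans (hs' j hj))
  simp only [Finset.mem_range]
  omega

/-- The new value must land just below or just above the last one. If the preceding gap is marked,
one side would break that pair, so the direction of the block is already fixed. -/
theorem numCompat_succ_insert {n : ℕ} {s : Finset ℕ} (hs : s ⊆ Finset.range n) :
    numCompat (n + 1) (insert n s) = (if n ∈ s.image Nat.succ then 1 else 2) * numCompat n s := by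
  have hs' : ∀ j ∈ s, j + 1 < n + 1 := fun j hj => by simpa using hs hj
  refine card_filter_appendValue (n + 1)
    (fun v σ => v ∉ slots σ s ∧ (v = word σ n ∨ v = word σ n + 1)) _ _ _
    (fun v σ => ?_) fun σ hσ => ?_
  · rw [← and_assoc, ← compat_appendValue v σ hs', and_comm]
    simp only [Compat, Finset.forall_mem_insert]
    rw [word_appendValue_last, word_appendValue v σ (by omega)]
    refine and_congr_left' ?_
    unfold Adj
    split_ifs <;> omega
  · have hn := word_lt σ n.lt_succ_self
    have key : ∀ j ∈ s, j + 1 ≠ n → max (word σ j) (word σ (j + 1)) ≠ word σ n ∧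
        max (word σ j) (word σ (j + 1)) ≠ word σ n + 1 := by
      intro j hj hjn
      have h1 := hσ j hj
      have h2 := hs' j hj
      have e1 := word_injOn σ (i := j) (j := n) (by omega) (by omega)
      have e2 := word_injOn σ (i := j + 1) (j := n) (by omega) (by omega)
      unfold Adj at h1
      omega
    split_ifs with hl
    · obtain ⟨k, hk, rfl⟩ := Finset.mem_image.1 hl
      have hk' := hσ k hk
      have hkl := word_lt σ (hs' k hk)
      have hkl' := word_lt σ (k.lt_succ_self.trans (hs' k hk))
      rw [Finset.card_eq_one]
      -- The two candidates sum to `2 * word σ (k + 1) + 1`; the excluded one is the maximum.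
      refine ⟨2 * word σ (k + 1) + 1 - max (word σ k) (word σ (k + 1)), ?_⟩
      ext v
      simp only [Finset.mem_filter, Finset.mem_range, Finset.mem_singleton, slots,
        Finset.mem_image, not_exists, not_and, Nat.succ_eq_add_one]
      unfold Adj at hk'
      constructor
      · rintro ⟨-, h1, h2⟩
        have := h1 k hk
        omega
      · intro hv
        refine ⟨by simp only [Nat.succ_eq_add_one] at hn ⊢; omega, fun j hj => ?_, by omega⟩
        by_cases hjk : j = k
        · subst hjk; omega
        · have := key j hj (by simpa using hjk)
          simp only [Nat.succ_eq_add_one] at this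
          omega
    · have : ((Finset.range (n + 1 + 1)).filter fun v =>
          v ∉ slots σ s ∧ (v = word σ n ∨ v = word σ n + 1)) = {word σ n, word σ n + 1} := by
        ext v
        simp only [Finset.mem_filter, Finset.mem_range, Finset.mem_singleton, slots,
          Finset.mem_image, not_exists, not_and, Finset.mem_insert]
        constructor
        · exact fun h => h.2.2
        · intro hv
          refine ⟨by omega, fun j hj => ?_, hv⟩
          have := key j hj (fun h => hl (Finset.mem_image.2 ⟨j, hj, h⟩))
          omega
      rw [this, Finset.card_pair (by omega)]

end PermSep

/-! ### Block polynomials and the factorial functional -/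

namespace PermSep
open Polynomial

variable {R : Type*} [CommRing R]

/-- The linear functional sending `X ^ m` to `m! * f m`. -/
noncomputable def factorialFunctional (f : ℕ → R) : R[X] →ₗ[R] R :=
  lsum fun m => ((m ! : R) * f m) • LinearMap.id

theorem factorialFunctional_apply (f : ℕ → R) (p : R[X]) :
    factorialFunctional f p = p.sum fun m c => (m ! : R) * f m * c := by
  simp [factorialFunctional, lsum_apply]

theorem factorialFunctional_monomial (f : ℕ → R) (m : ℕ) (c : R) :
    factorialFunctional f (monomial m c) = (m ! : R) * f m * c := by
  rw [factorialFunctional_apply, sum_monomial_index _ _ (by simp)]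

theorem factorialFunctional_X_mul (f : ℕ → R) (p : R[X]) :
    factorialFunctional f (X * p) =
      factorialFunctional (fun m => ((m + 1 : ℕ) : R) * f (m + 1)) p := by
  induction p using Polynomial.induction_on' with
  | add p q hp hq => rw [mul_add, map_add, map_add, hp, hq]
  | monomial m c =>
    rw [X_mul_monomial, factorialFunctional_monomial, factorialFunctional_monomial,
      Nat.factorial_succ]
    push_cast
    ring

/-- The generating polynomials, by number of blocks, of weighted markings of the first `n` gaps,
split according to whether the last gap is unmarked or marked. -/
noncomputable def markPoly (τ : ℕ → R) : ℕ → R[X] × R[X]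
  | 0 => (X, 0)
  | n + 1 => (X * ((markPoly τ n).1 + (markPoly τ n).2),
      C (τ n) * (2 * (markPoly τ n).1 + (markPoly τ n).2))

/-- Here `n + 1 - s.card` is the number of blocks. General `f`, `a`, `b` make the induction close:
an unmarked gap replaces `f m` by `(m + 1) * f (m + 1)`, and a marked one uses `a = 2`, `b = 1`. -/
theorem sum_powerset_numCompat (τ : ℕ → R) (n : ℕ) (f : ℕ → R) (a b : R) :
    ∑ s ∈ (Finset.range n).powerset, (∏ j ∈ s, τ j) * numCompat n s * f (n + 1 - s.card) *
        (if n ∈ s.image Nat.succ then b else a) =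
      a * factorialFunctional f (markPoly τ n).1 + b * factorialFunctional f (markPoly τ n).2 := by
  induction n generalizing f a b with
  | zero =>
    have := factorialFunctional_monomial f 1 (1 : R)
    rw [monomial_one_one_eq_X] at this
    simp [numCompat_zero, markPoly, this, mul_comm]
  | succ n ih =>
    rw [Finset.range_add_one, Finset.sum_powerset_insert Finset.notMem_range_self, markPoly,
      factorialFunctional_X_mul, ← smul_eq_C_mul, map_smul, smul_eq_mul, map_add, mul_add, ← ih,
      two_mul, map_add, map_add, ← two_mul,
      ← one_mul (factorialFunctional f (markPoly τ n).2), ← ih, Finset.mul_sum, Finset.mul_sum]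
    refine congrArg₂ _ (Finset.sum_congr rfl fun s hs => ?_) (Finset.sum_congr rfl fun s hs => ?_)
    · have hs' := Finset.mem_powerset.1 hs
      have hc : s.card ≤ n := by simpa using Finset.card_le_card hs'
      have hl : n + 1 ∉ s.image Nat.succ := by
        simp only [Finset.mem_image, Nat.succ_eq_add_one, add_left_inj, exists_eq_right]
        exact fun h => Finset.notMem_range_self (hs' h)
      rw [if_neg hl, numCompat_succ hs', ite_self, show n + 2 - s.card = n + 1 - s.card + 1 by omega]
      push_cast
      ring
    · have hs' := Finset.mem_powerset.1 hs
      have hc : s.card ≤ n := by simpa using Finset.card_le_card hs'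
      have hn : n ∉ s := fun h => Finset.notMem_range_self (hs' h)
      have hl : n + 1 ∈ (insert n s).image Nat.succ :=
        Finset.mem_image.2 ⟨n, Finset.mem_insert_self _ _, rfl⟩
      rw [if_pos hl, numCompat_succ_insert hs', Finset.card_insert_of_notMem hn,
        Finset.prod_insert hn, show n + 1 + 1 - (s.card + 1) = n + 1 - s.card by omega]
      push_cast
      ring

theorem sum_prod_one_add_adj (τ : ℕ → R) (n : ℕ) :
    ∑ σ : Equiv.Perm (Fin (n + 1)), ∏ j ∈ Finset.range n,
        (1 + if Adj (word σ j) (word σ (j + 1)) then τ j else 0) =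
      factorialFunctional 1 ((markPoly τ n).1 + (markPoly τ n).2) := by
  have h := sum_powerset_numCompat τ n 1 1 1
  simp only [one_mul, ite_self, mul_one, Pi.one_apply] at h
  rw [map_add, ← h]
  simp only [Finset.prod_one_add]
  rw [Finset.sum_comm]
  refine Finset.sum_congr rfl fun s _ => ?_
  rw [numCompat, Finset.card_filter, Nat.cast_sum, Finset.mul_sum]
  refine Finset.sum_congr rfl fun σ _ => ?_
  rw [Finset.prod_ite_zero]
  by_cases h : Compat σ s
  · rw [if_pos h, if_pos (show ∀ j ∈ s, _ from h), Nat.cast_one, mul_one]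
  · rw [if_neg h, if_neg (show ¬∀ j ∈ s, _ from h), Nat.cast_zero, mul_zero]

theorem markPoly_congr {τ τ' : ℕ → R} {n : ℕ} (h : ∀ j < n, τ j = τ' j) :
    markPoly τ n = markPoly τ' n := by
  induction n with
  | zero => rfl
  | succ n ih => rw [markPoly, markPoly, ih fun j hj => h j (by omega), h n (by omega)]

/-- A gap of weight zero restarts the linear recursion from a multiple of its initial value `(X,
0)`. -/
theorem markPoly_add {τ : ℕ → R} {a : ℕ} (h : τ a = 0) (k : ℕ) :
    markPoly τ (a + 1 + k) =
      (((markPoly τ a).1 + (markPoly τ a).2) * (markPoly (fun j => τ (a + 1 + j)) k).1,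
       ((markPoly τ a).1 + (markPoly τ a).2) * (markPoly (fun j => τ (a + 1 + j)) k).2) := by
  induction k with
  | zero => simp [markPoly, h, mul_comm]
  | succ k ih =>
    rw [← add_assoc, markPoly, ih, markPoly]
    ext1 <;> simp only <;> ring

/-- The generating polynomial, by number of blocks, of the markings of `a` consecutive
positions when every marked gap has weight `t`. -/
noncomputable def blockPoly (t : R) : ℕ → R[X]
  | 0 => 1
  | a + 1 => (markPoly (fun _ => t) a).1 + (markPoly (fun _ => t) a).2

theorem blockPoly_one (t : R) : blockPoly t 1 = X := by simp [blockPoly, markPoly]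

theorem blockPoly_add_two (t : R) (a : ℕ) :
    blockPoly t (a + 2) = (X + C t) * blockPoly t (a + 1) + C t * X * blockPoly t a := by
  cases a with
  | zero => simp only [blockPoly, markPoly]; ring
  | succ a => simp only [blockPoly, markPoly]; ring

theorem blockPoly_mul_blockPoly (t : R) (a b : ℕ) :
    (markPoly (fun j => if j = a then 0 else t) (a + b)).1 +
      (markPoly (fun j => if j = a then 0 else t) (a + b)).2 =
    blockPoly t (a + 1) * blockPoly t b := by
  have h1 : markPoly (fun j => if j = a then 0 else t) a = markPoly (fun _ => t) a :=
    markPoly_congr fun j hj => if_neg hj.ne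
  cases b with
  | zero => simp [blockPoly, h1]
  | succ b =>
    have h2 : markPoly (fun j => if a + 1 + j = a then 0 else t) b = markPoly (fun _ => t) b :=
      markPoly_congr fun j _ => if_neg (by omega)
    rw [show a + (b + 1) = a + 1 + b by omega, markPoly_add (by simp), h1, h2, blockPoly, blockPoly]
    ring

end PermSep

/-! ### Reordering positions by parity; inversion -/

namespace PermSep

/-- The position listed at place `j` when the even positions come first (there are `a` of them)
and the odd positions follow. -/
def parityOrder (a j : ℕ) : ℕ := if j < a then 2 * j else 2 * (j - a) + 1

theorem parityOrder_lt {n j : ℕ} (hj : j < n + 1) : parityOrder (n / 2 + 1) j < n + 1 := by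
  unfold parityOrder; split_ifs <;> omega

/-- The permutation listing the even positions before the odd ones. -/
noncomputable def parityPerm (n : ℕ) : Equiv.Perm (Fin (n + 1)) :=
  Equiv.ofBijective (fun j => ⟨parityOrder (n / 2 + 1) j, parityOrder_lt j.2⟩) <| by
    rw [← Finite.injective_iff_bijective]
    intro i j h
    simp only [Fin.mk.injEq, parityOrder] at h
    ext
    split_ifs at h <;> omega

theorem word_mul_parityPerm {n : ℕ} (π : Equiv.Perm (Fin (n + 1))) {j : ℕ} (hj : j < n + 1) :
    word (π * parityPerm n) j = word π (parityOrder (n / 2 + 1) j) := by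
  rw [word_of_lt _ hj, word_of_lt _ (parityOrder_lt hj)]
  rfl

theorem parityOrder_succ {n j : ℕ} (hj : j ≠ n / 2) (hn : j < n) :
    parityOrder (n / 2 + 1) (j + 1) = parityOrder (n / 2 + 1) j + 2 ∧
      parityOrder (n / 2 + 1) j + 2 < n + 1 := by
  unfold parityOrder; split_ifs <;> omega

theorem card_verticalSeparators {n : ℕ} (π : Equiv.Perm (Fin (n + 1))) :
    (verticalSeparators π).card = ((Finset.range n).filter fun j => j ≠ n / 2 ∧
      Adj (word (π * parityPerm n) j) (word (π * parityPerm n) (j + 1))).card := by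
  symm
  have hlt : ∀ j ∈ (Finset.range n).filter (fun j => j ≠ n / 2 ∧
      Adj (word (π * parityPerm n) j) (word (π * parityPerm n) (j + 1))),
      parityOrder (n / 2 + 1) j + 1 < n + 1 := by
    intro j hj
    simp only [Finset.mem_filter, Finset.mem_range] at hj
    have := parityOrder_succ hj.2.1 hj.1
    omega
  refine Finset.card_bij (fun j hj => π ⟨parityOrder (n / 2 + 1) j + 1, hlt j hj⟩) ?_ ?_ ?_
  · intro j hj
    simp only [Finset.mem_filter, Finset.mem_range] at hj
    obtain ⟨hjn, hja, hadj⟩ := hj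
    obtain ⟨h1, h2⟩ := parityOrder_succ hja hjn
    rw [word_mul_parityPerm _ (by omega), word_mul_parityPerm _ (by omega), h1,
      word_of_lt _ (by omega), word_of_lt _ h2] at hadj
    simp only [verticalSeparators, Finset.mem_filter, Finset.mem_univ, true_and]
    exact ⟨⟨parityOrder (n / 2 + 1) j, by omega⟩, _, ⟨_, h2⟩, rfl, rfl, rfl, hadj⟩
  · intro i hi j hj hij
    have h := congrArg Fin.val (π.injective hij)
    simp only [Finset.mem_filter, Finset.mem_range] at hi hj
    simp only [parityOrder] at h
    split_ifs at h <;> omega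
  · intro b hb
    simp only [verticalSeparators, Finset.mem_filter, Finset.mem_univ, true_and] at hb
    obtain ⟨j₁, i, j₂, rfl, h1, h2, hadj⟩ := hb
    have hj₂ := j₂.2
    obtain ⟨j, hjn, hja, hj⟩ : ∃ j, j < n ∧ j ≠ n / 2 ∧ parityOrder (n / 2 + 1) j = j₁ := by
      unfold parityOrder
      rcases Nat.even_or_odd' (j₁ : ℕ) with ⟨c, hc | hc⟩
      · exact ⟨c, by omega, by omega, by rw [if_pos (by omega)]; omega⟩
      · exact ⟨n / 2 + 1 + c, by omega, by omega, by rw [if_neg (by omega)]; omega⟩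
    refine ⟨j, ?_, ?_⟩
    · simp only [Finset.mem_filter, Finset.mem_range]
      refine ⟨hjn, hja, ?_⟩
      rw [word_mul_parityPerm _ (by omega), word_mul_parityPerm _ (by omega),
        (parityOrder_succ hja hjn).1, hj, word_of_lt _ (by omega), word_of_lt _ (by omega)]
      have : (⟨(j₁ : ℕ) + 2, by omega⟩ : Fin (n + 1)) = j₂ := Fin.ext (by simp only; omega)
      rw [this]
      exact hadj
    · congr 1
      ext
      simp only
      omega

theorem sum_pow_card_verticalSeparators {R : Type*} [CommRing R] (x : R) (n : ℕ) :
    ∑ π : Equiv.Perm (Fin n), x ^ (verticalSeparators π).card =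
      factorialFunctional 1 (blockPoly (x - 1) ((n + 1) / 2) * blockPoly (x - 1) (n / 2)) := by
  cases n with
  | zero =>
    have := factorialFunctional_monomial (1 : ℕ → R) 0 1
    rw [Polynomial.monomial_zero_one] at this
    simp [blockPoly, this, verticalSeparators]
  | succ n =>
    -- Gap `n / 2` joins the last even position to the first odd one, so it carries weight zero.
    have h := sum_prod_one_add_adj (fun j => if j = n / 2 then 0 else x - 1) n
    have hb := blockPoly_mul_blockPoly (x - 1) (n / 2) (n - n / 2)
    rw [show n / 2 + (n - n / 2) = n by omega] at hb
    rw [hb] at h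
    rw [show (n + 1 + 1) / 2 = n / 2 + 1 by omega, show (n + 1) / 2 = n - n / 2 by omega, ← h]
    conv_rhs => rw [← Equiv.sum_comp (Equiv.mulRight (parityPerm n))]
    refine Finset.sum_congr rfl fun π _ => ?_
    rw [card_verticalSeparators, ← Finset.prod_const, Finset.prod_filter]
    refine Finset.prod_congr rfl fun j _ => ?_
    rw [Equiv.coe_mulRight]
    by_cases h1 : j = n / 2 <;>
      by_cases h2 : Adj (word (π * parityPerm n) j) (word (π * parityPerm n) (j + 1)) <;>
      simp [h1, h2]

theorem coeff_bivariateGF_card (S : ∀ {n : ℕ}, Equiv.Perm (Fin n) → Finset (Fin n)) (n : ℕ) :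
    PowerSeries.coeff n (bivariateGF fun n m =>
        (Finset.univ.filter fun π : Equiv.Perm (Fin n) => (S π).card = m).card) =
      ∑ π : Equiv.Perm (Fin n), (PowerSeries.X : QU) ^ (S π).card := by
  rw [bivariateGF, PowerSeries.coeff_mk, ← Finset.sum_fiberwise_of_maps_to
    (g := fun π : Equiv.Perm (Fin n) => (S π).card) (t := Finset.range (n + 1))]
  · refine Finset.sum_congr rfl fun m _ => ?_
    rw [Finset.sum_congr rfl (g := fun _ => (PowerSeries.X : QU) ^ m)
      fun π hπ => by rw [(Finset.mem_filter.1 hπ).2], Finset.sum_const, nsmul_eq_mul]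
    simp
  · intro π _
    have := Finset.card_le_univ (S π)
    rw [Fintype.card_fin] at this
    exact Finset.mem_range.2 (by omega)

theorem verticalSeparators_inv {n : ℕ} (π : Equiv.Perm (Fin n)) :
    verticalSeparators π⁻¹ = (horizontalSeparators π).map π⁻¹.toEmbedding := by
  ext b
  simp only [verticalSeparators, horizontalSeparators, Finset.mem_map, Finset.mem_filter,
    Finset.mem_univ, true_and, Equiv.coe_toEmbedding]
  constructor
  · rintro ⟨j₁, i, j₂, rfl, h1, h2, h⟩
    exact ⟨i, ⟨π⁻¹ j₁, π⁻¹ j₂, by simpa using h1, by simpa using h2, h⟩, rfl⟩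
  · rintro ⟨i, ⟨j₁, j₂, h1, h2, h⟩, rfl⟩
    exact ⟨π j₁, i, π j₂, rfl, h1, h2, by simpa using h⟩

theorem numHorizontal_eq_numVertical (n m : ℕ) : numHorizontal n m = numVertical n m := by
  refine Finset.card_equiv (Equiv.inv _) fun π => ?_
  simp [verticalSeparators_inv]

theorem horizontalGF_eq_verticalGF : horizontalGF = verticalGF := by
  rw [horizontalGF, verticalGF]
  congr 1
  funext n m
  exact numHorizontal_eq_numVertical n m

end PermSep

/-! ### Coefficients of the powers of `w` -/

namespace PermSep
open PowerSeries

theorem u_sub_one : u - 1 = C (X - 1 : QU) := by simp [u]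

theorem w_eq : w = z ^ 2 * (1 + (u - 1) * w + z ^ 2 * (u - 1)) := by
  have h := denominator_mul_inv
  simp only [w]
  linear_combination (2 * z ^ 4 * (u - 1)) * h

theorem w_pow_succ (m : ℕ) :
    w ^ (m + 1) = X ^ 2 * (w ^ m + C (X - 1 : QU) * w ^ (m + 1) +
      X ^ 2 * (C (X - 1 : QU) * w ^ m)) := by
  have h := w_eq
  rw [u_sub_one, z] at h
  linear_combination w ^ m * h

theorem coeff_w_pow_eq_zero {k m : ℕ} (h : k < m) : coeff k (w ^ m) = 0 := by
  have hw : (X : QUZ) ∣ w := by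
    rw [w_eq, z, pow_two, mul_assoc]
    exact dvd_mul_right _ _
  exact X_pow_dvd_iff.1 (pow_dvd_pow_of_dvd hw m) k h

theorem coeff_add_two_w_pow_succ (k m : ℕ) : coeff (k + 2) (w ^ (m + 1)) =
    coeff k (w ^ m) + (X - 1) * coeff k (w ^ (m + 1)) +
      if 2 ≤ k then (X - 1) * coeff (k - 2) (w ^ m) else 0 := by
  rw [w_pow_succ, coeff_X_pow_mul, map_add, map_add, coeff_C_mul, coeff_X_pow_mul', coeff_C_mul]
  rw [← w_pow_succ]

/-- The recursion `blockPoly_add_two` and the functional equation `w_eq` give the same recurrence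
for the coefficients. -/
theorem coeff_w_pow (k m : ℕ) :
    coeff (2 * k) (w ^ m) = (blockPoly (X - 1 : QU) k).coeff m ∧
      coeff (2 * k + 1) (w ^ m) = 0 := by
  induction k using Nat.twoStepInduction generalizing m with
  | zero =>
    cases m with
    | zero => simp [blockPoly, coeff_one]
    | succ m =>
      rw [w_pow_succ, coeff_X_pow_mul', coeff_X_pow_mul']
      simp [blockPoly, Polynomial.coeff_one]
  | one =>
    rw [blockPoly_one, Polynomial.coeff_X]
    cases m with
    | zero => simp [coeff_one]
    | succ m =>
      rw [show 2 * 1 + 1 = 1 + 2 by rfl, show 2 * 1 = 0 + 2 by rfl, coeff_add_two_w_pow_succ,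
        coeff_add_two_w_pow_succ, coeff_w_pow_eq_zero m.succ_pos, w_pow_succ, coeff_X_pow_mul']
      cases m with
      | zero => simp [coeff_one]
      | succ m =>
        rw [coeff_w_pow_eq_zero m.succ_pos, w_pow_succ, coeff_X_pow_mul']
        simp
  | more k ih0 ih1 =>
    rw [blockPoly_add_two, Polynomial.coeff_add, add_mul, Polynomial.coeff_add,
      Polynomial.coeff_C_mul, mul_assoc, Polynomial.coeff_C_mul]
    cases m with
    | zero =>
      have h := (ih1 0).1
      rw [pow_zero, coeff_one, if_neg (by omega)] at h
      simp [coeff_one, ← h]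
    | succ m =>
      rw [show 2 * (k + 2) + 1 = 2 * (k + 1) + 1 + 2 by ring,
        show 2 * (k + 2) = 2 * (k + 1) + 2 by ring, coeff_add_two_w_pow_succ,
        coeff_add_two_w_pow_succ, (ih1 m).1, (ih1 m).2, (ih1 (m + 1)).1, (ih1 (m + 1)).2,
        if_pos (by omega), if_pos (by omega), show 2 * (k + 1) + 1 - 2 = 2 * k + 1 by omega,
        show 2 * (k + 1) - 2 = 2 * k by omega, (ih0 m).1, (ih0 m).2, Polynomial.coeff_X_mul,
        Polynomial.coeff_X_mul]
      simp

theorem factorialFunctional_blockPoly_mul {a b K : ℕ} (ha : 2 * a < K) (hb : 2 * b < K) :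
    factorialFunctional 1 (blockPoly (X - 1 : QU) a * blockPoly (X - 1 : QU) b) =
      ∑ p ∈ Finset.range K ×ˢ Finset.range K,
        ((p.1 + p.2)! : QU) * (coeff (2 * a) (w ^ p.1) * coeff (2 * b) (w ^ p.2)) := by
  have key : ∀ c, 2 * c < K → blockPoly (X - 1 : QU) c =
      ∑ i ∈ Finset.range K, Polynomial.monomial i (coeff (2 * c) (w ^ i)) := by
    intro c hc
    have hdeg : (blockPoly (X - 1 : QU) c).natDegree ≤ 2 * c := by
      rw [Polynomial.natDegree_le_iff_coeff_eq_zero]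
      intro m hm
      rw [← (coeff_w_pow c m).1, coeff_w_pow_eq_zero hm]
    simp only [(coeff_w_pow c _).1]
    exact Polynomial.as_sum_range' _ _ (hdeg.trans_lt hc)
  rw [key a ha, key b hb, Finset.sum_mul_sum, map_sum, Finset.sum_product]
  refine Finset.sum_congr rfl fun i _ => ?_
  rw [map_sum]
  refine Finset.sum_congr rfl fun j _ => ?_
  rw [Polynomial.monomial_mul_monomial, factorialFunctional_monomial]
  simp

theorem coeff_verticalGF (n : ℕ) : coeff n verticalGF =
    ∑ p ∈ Finset.range (n + 2) ×ˢ Finset.range (n + 2), ((p.1 + p.2)! : QU) *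
      (coeff (2 * ((n + 1) / 2)) (w ^ p.1) * coeff (2 * (n / 2)) (w ^ p.2)) := by
  rw [← factorialFunctional_blockPoly_mul (by omega) (by omega),
    ← sum_pow_card_verticalSeparators]
  exact coeff_bivariateGF_card verticalSeparators n

/-! ### Laurent coefficients and summability -/

theorem coeff_w_pow_coe (m : ℕ) (g : ℤ) : ((w : LaurentSeries QU) ^ m).coeff g =
    if g < 0 then 0 else coeff g.natAbs (w ^ m) := by
  rw [← coe_pow, coeff_coe]

theorem coeff_w_pow_mul_zInv (m : ℕ) (g : ℤ) :
    ((w : LaurentSeries QU) ^ m * zInv).coeff g = ((w : LaurentSeries QU) ^ m).coeff (g + 1) := by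
  rw [zInv, HahnSeries.coeff_mul_single, mul_one, sub_neg_eq_add]

theorem coeff_w_pow_mul_z (m : ℕ) (g : ℤ) :
    ((w : LaurentSeries QU) ^ m * (z : LaurentSeries QU)).coeff g =
      ((w : LaurentSeries QU) ^ m).coeff (g - 1) := by
  rw [z, coe_X, HahnSeries.coeff_mul_single, mul_one]

theorem coeff_factorial_smul_hadamard (k : ℕ) (f g : LaurentSeries QU) (i : ℤ) :
    (k ! • hadamard f g).coeff i = (k ! : QU) * (f.coeff i * g.coeff i) := by
  rw [HahnSeries.coeff_smul, nsmul_eq_mul]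
  rfl

/-- A family of Laurent series indexed by `ℕ × ℕ` whose member at `p` is supported in degrees
`g ≥ 0` with `p.1, p.2 ≤ g + 1` is summable. -/
noncomputable def summableFamilyOfBound {R : Type*} [Semiring R] (F : ℕ × ℕ → LaurentSeries R)
    (h : ∀ p g, (F p).coeff g ≠ 0 → 0 ≤ g ∧ (p.1 : ℤ) < g + 2 ∧ (p.2 : ℤ) < g + 2) :
    HahnSeries.SummableFamily ℤ R (ℕ × ℕ) where
  toFun := F
  isPWO_iUnion_support' := by
    refine (BddBelow.isWF ⟨0, ?_⟩).isPWO
    intro g hg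
    obtain ⟨p, hp⟩ := Set.mem_iUnion.1 hg
    exact (h p g hp).1
  finite_co_support' g := by
    refine (Finset.finite_toSet (Finset.range (g + 2).toNat ×ˢ Finset.range (g + 2).toNat)).subset ?_
    intro p hp
    have := h p g hp
    simp only [Finset.coe_product, Finset.coe_range, Set.mem_prod, Set.mem_Iio]
    omega

theorem coeff_hsum_summableFamilyOfBound {R : Type*} [Semiring R] (F : ℕ × ℕ → LaurentSeries R)
    (h : ∀ p g, (F p).coeff g ≠ 0 → 0 ≤ g ∧ (p.1 : ℤ) < g + 2 ∧ (p.2 : ℤ) < g + 2) (g : ℤ) :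
    (summableFamilyOfBound F h).hsum.coeff g = if g < 0 then 0 else
      ∑ p ∈ Finset.range (g.natAbs + 2) ×ˢ Finset.range (g.natAbs + 2), (F p).coeff g := by
  have hF : ∀ p, summableFamilyOfBound F h p = F p := fun _ => rfl
  split_ifs with hg
  · rw [HahnSeries.SummableFamily.coeff_hsum]
    refine finsum_eq_zero_of_forall_eq_zero fun p => ?_
    by_contra hp
    exact absurd (h p g hp).1 (by omega)
  · rw [HahnSeries.SummableFamily.coeff_hsum_eq_sum_of_subset
      (t := Finset.range (g.natAbs + 2) ×ˢ Finset.range (g.natAbs + 2))]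
    · simp only [hF]
    intro p hp
    have := h p g hp
    simp only [Finset.coe_product, Finset.coe_range, Set.mem_prod, Set.mem_Iio]
    omega

end PermSep

/-- The double sums over `(m_o, m_e)` are formal sums of Laurent series in `z` over `ℚ[[u]]`.
That they make sense (each coefficient receives only finitely many nonzero contributions)
is part of the conclusion: the terms form summable families `E` and `O`. -/
theorem mainTheorem3 :
    ∃ E O : HahnSeries.SummableFamily ℤ PermSep.QU (ℕ × ℕ),
      (∀ mo me : ℕ, E (mo, me) =
        (mo + me)! • PermSep.hadamard
          ((PermSep.w : LaurentSeries PermSep.QU) ^ mo)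
          ((PermSep.w : LaurentSeries PermSep.QU) ^ me)) ∧
      (∀ mo me : ℕ, O (mo, me) =
        (mo + me)! • PermSep.hadamard
          ((PermSep.w : LaurentSeries PermSep.QU) ^ mo * PermSep.zInv)
          ((PermSep.w : LaurentSeries PermSep.QU) ^ me * (PermSep.z : LaurentSeries PermSep.QU))) ∧
      (PermSep.verticalGF : LaurentSeries PermSep.QU) = E.hsum + O.hsum ∧
      (PermSep.horizontalGF : LaurentSeries PermSep.QU) = E.hsum + O.hsum := by
  open PermSep in
  have hw : ∀ (m : ℕ) (g : ℤ), ((w : LaurentSeries QU) ^ m).coeff g ≠ 0 → 0 ≤ g ∧ (m : ℤ) ≤ g := by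
    intro m g h
    rw [coeff_w_pow_coe] at h
    split_ifs at h with hg
    · exact absurd rfl h
    · have := mt (coeff_w_pow_eq_zero (k := g.natAbs) (m := m)) h
      omega
  refine ⟨summableFamilyOfBound (fun p => (p.1 + p.2)! •
      hadamard ((w : LaurentSeries QU) ^ p.1) ((w : LaurentSeries QU) ^ p.2)) ?_,
    summableFamilyOfBound (fun p => (p.1 + p.2)! •
      hadamard ((w : LaurentSeries QU) ^ p.1 * zInv)
        ((w : LaurentSeries QU) ^ p.2 * (z : LaurentSeries QU))) ?_,
    fun _ _ => rfl, fun _ _ => rfl, ?_⟩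
  · intro p g h
    rw [coeff_factorial_smul_hadamard] at h
    have h1 := hw _ _ (left_ne_zero_of_mul (right_ne_zero_of_mul h))
    have h2 := hw _ _ (right_ne_zero_of_mul (right_ne_zero_of_mul h))
    omega
  · intro p g h
    rw [coeff_factorial_smul_hadamard, coeff_w_pow_mul_zInv, coeff_w_pow_mul_z] at h
    have h1 := hw _ _ (left_ne_zero_of_mul (right_ne_zero_of_mul h))
    have h2 := hw _ _ (right_ne_zero_of_mul (right_ne_zero_of_mul h))
    omega
  · rw [horizontalGF_eq_verticalGF, and_self]
    ext1
    funext g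
    rw [HahnSeries.coeff_add, coeff_hsum_summableFamilyOfBound, coeff_hsum_summableFamilyOfBound,
      PowerSeries.coeff_coe]
    split_ifs with hg
    · simp
    obtain ⟨n, rfl⟩ := Int.eq_ofNat_of_zero_le (not_lt.1 hg)
    rw [Int.natAbs_natCast, coeff_verticalGF, ← Finset.sum_add_distrib]
    refine Finset.sum_congr rfl fun p _ => ?_
    rw [coeff_factorial_smul_hadamard, coeff_factorial_smul_hadamard, coeff_w_pow_mul_zInv,
      coeff_w_pow_mul_z]
    simp only [coeff_w_pow_coe, if_neg hg, Int.natAbs_natCast]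
    rw [if_neg (by omega), show ((n : ℤ) + 1).natAbs = n + 1 by omega]
    -- Odd coefficients of `w ^ m` vanish, so for each parity of `n` only one family contributes.
    obtain ⟨k, rfl | rfl⟩ := Nat.even_or_odd' n
    · rw [(coeff_w_pow k p.1).1, (coeff_w_pow k p.2).1, (coeff_w_pow k p.1).2,
        show (2 * k + 1) / 2 = k by omega, show 2 * k / 2 = k by omega, (coeff_w_pow k p.1).1,
        (coeff_w_pow k p.2).1]
      ring
    · rw [(coeff_w_pow k p.1).2, if_neg (by omega),
        show (((2 * k + 1 : ℕ) : ℤ) - 1).natAbs = 2 * k by omega,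
        show 2 * ((2 * k + 1 + 1) / 2) = 2 * k + 1 + 1 by omega,
        show 2 * ((2 * k + 1) / 2) = 2 * k by omega]
      ring
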